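/- Let $k$ be a commutative Artinian ring, let $J$ be the injective envelope of the $k$-module $k/\operatorname{rad}k$, put $D=\operatorname{Hom}_k(-,J)$, and let $A$ be an Artin $k$-algebra, i.e. a $k$-algebra that is finitely generated as a $k$-module. Modules are left modules and, unless stated otherwise, finitely generated. An $A$-module $G$ is Gorenstein-projective if $G\cong\operatorname{Ker}d^0$ for an exact complex $\cdots\to P^{-1}\to P^0\xrightarrow{d^0}P^1\to\cdots$ of finitely generated projective $A$-modules that stays exact under $\operatorname{Hom}_A(-,Q)$ for every finitely generated projective $Q$. The algebra $A$ is of finite CM-type if there are only finitely many isomorphism classes of indecomposable Gorenstein-projective $A$-modules; assume this, let $E_1,\dots,E_n$ be a complete list of representatives without repetition, put $E=\bigoplus_{i=1}^nE_i$, and let $\Lambda=A(\mathrm{Gproj})=\operatorname{End}_A(E)^{\mathrm{op}}$ be the CM-Auslander algebra of $A$. Thus $E$ is an $A$-$\Lambda$-bimodule. A proper Gorenstein-projective presentation of an $A$-module $M$ is an exact sequence $G_1\xrightarrow{\theta}G_0\xrightarrow{\pi}M\to0$ with $G_0,G_1$ Gorenstein-projective such that $\operatorname{Hom}_A(G,G_1)\to\operatorname{Hom}_A(G,G_0)\to\operatorname{Hom}_A(G,M)\to0$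 is exact for every Gorenstein-projective $G$. It is minimal if $G_0\to M$ and $G_1\to\operatorname{Im}\theta$ are right minimal, where a map $f$ is right minimal if every endomorphism $\varphi$ of its source with $f\varphi=f$ is an automorphism. For a minimal such presentation put $\operatorname{Tr}_GM=\operatorname{Coker}\bigl(\operatorname{Hom}_A(G_0,E)\to\operatorname{Hom}_A(G_1,E)\bigr)$, a right $\Lambda$-module, and $\tau_GM=D\operatorname{Tr}_GM$, a left $\Lambda$-module. The module $M$ is $\tau_G$-rigid if $\operatorname{Hom}_\Lambda(\operatorname{Hom}_A(E,M),\tau_GM)=0$, and $A$ is $\tau_G$-tilting finite if there are only finitely many isomorphism classes of indecomposable $\tau_G$-rigid $A$-modules. A $\Lambda$-module $N$ is $\tau$-rigid if $\operatorname{Hom}_\Lambda(N,\tau N)=0$, where $\tau N=D\operatorname{Coker}\bigl(\operatorname{Hom}_\Lambda(P_0,\Lambda)\to\operatorname{Hom}_\Lambda(P_1,\Lambda)\bigr)$ for a minimal projective presentation $P_1\to P_0\to N\to0$; and $\Lambda$ is $\tau$-tilting finite if there are only finitely many isomorphism classes of indecomposable $\tau$-rigid $\Lambda$-modules. A $G$-epimorphism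 is an epimorphism $g$ of arbitrary $A$-modules such that $\operatorname{Hom}_A(G,g)$ is surjective for every Gorenstein-projective $G$; a short exact sequence is $G$-exact if its epimorphism is a $G$-epimorphism. For $\theta:G_1\to G_0$ let $D_\theta$ be the class of all, not necessarily finitely generated, $A$-modules $X$ such that $\operatorname{Hom}_A(\theta,X)$ is surjective. An $A$-module $T$ is partial Gorenstein silting if it has a proper Gorenstein-projective presentation $G_1\xrightarrow{\theta}G_0\to T\to0$ such that $D_\theta$ is closed under $G$-epimorphic images, under extensions by $G$-exact sequences and under arbitrary coproducts, and $T\in D_\theta$. **Corollary 2.13.** Let $A$ be an Artin algebra of finite CM-type. If its CM-Auslander algebra $A(\mathrm{Gproj})$ is $\tau$-tilting finite, then $A$ is $\tau_G$-tilting finite, and moreover there are only finitely many isomorphism classes of indecomposable partial Gorenstein silting $A$-modules. -/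

import Mathlib

open scoped DirectSum

universe u v

namespace GorensteinSilting

/-! ## Generalities on modules -/

section General

variable {R : Type u} [Ring R]

/-- A nonzero module all of whose direct sum decompositions are trivial. -/
def IsIndecomposable (R : Type u) [Ring R] (M : Type u) [AddCommGroup M] [Module R M] : Prop :=
  Nontrivial M ∧ ∀ p q : Submodule R M, IsCompl p q → p = ⊥ ∨ q = ⊥

/-- The modules with the property `P` form only finitely many isomorphism classes: finitely many
modules represent all of them up to isomorphism. -/
def FinitelyManyIsoClasses (R : Type u) [Ring R] (P : ModuleCat.{u} R → Prop) : Prop :=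
  ∃ (n : ℕ) (X : Fin n → ModuleCat.{u} R), ∀ M : ModuleCat.{u} R, P M →
    ∃ i, Nonempty (M ≃ₗ[R] X i)

/-- `f` is right minimal: each endomorphism `φ` of its source with `f ∘ φ = f` is an
automorphism. -/
def IsRightMinimal {X Y : Type u} [AddCommGroup X] [Module R X] [AddCommGroup Y] [Module R Y]
    (f : X →ₗ[R] Y) : Prop :=
  ∀ φ : X →ₗ[R] X, f ∘ₗ φ = f → Function.Bijective φ

/-- `P₁ --σ--> P₀ --π--> N → 0` is a minimal projective presentation of `N` by finitely generated
projective modules: it is exact, and `P₀ → N` and `P₁ → Im σ` are projective covers, that is,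
right minimal epimorphisms from projective modules. -/
structure IsMinimalProjectivePresentation {P₁ P₀ N : Type u}
    [AddCommGroup P₁] [Module R P₁] [AddCommGroup P₀] [Module R P₀] [AddCommGroup N] [Module R N]
    (σ : P₁ →ₗ[R] P₀) (π : P₀ →ₗ[R] N) : Prop where
  finite₁ : Module.Finite R P₁
  finite₀ : Module.Finite R P₀
  projective₁ : Module.Projective R P₁
  projective₀ : Module.Projective R P₀
  exact : Function.Exact σ π
  surjective : Function.Surjective π
  minimal₀ : IsRightMinimal π
  minimal₁ : IsRightMinimal σ.rangeRestrict

end General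

/-- `J` is an injective envelope of the `k`-module `S`: `J` is injective and contains (a copy of)
`S` as an essential submodule. -/
def IsInjectiveEnvelope (k : Type v) [CommRing k] (S J : Type v) [AddCommGroup S] [Module k S]
    [AddCommGroup J] [Module k J] : Prop :=
  Module.Injective k J ∧ ∃ ι : S →ₗ[k] J, Function.Injective ι ∧
    ∀ p : Submodule k J, p ⊓ LinearMap.range ι = ⊥ → p = ⊥

/-! ## Gorenstein-projective modules and relative exactness -/

section GorensteinProjective

variable (A : Type u) [Ring A]

/-- `G` is (finitely generated) Gorenstein-projective: `G` is isomorphic to the kernel of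
`d⁰ : P⁰ → P¹` for an exact complex `⋯ → P⁻¹ → P⁰ → P¹ → ⋯` of finitely generated projective
modules that remains exact under `Hom_A(-, Q)` for every finitely generated projective `Q`. -/
def IsGorensteinProjective (G : Type u) [AddCommGroup G] [Module A G] : Prop :=
  ∃ (P : ℤ → ModuleCat.{u} A) (d : ∀ i : ℤ, P i →ₗ[A] P (i + 1)),
    (∀ i, Module.Finite A (P i) ∧ Module.Projective A (P i)) ∧
    (∀ i, Function.Exact (d i) (d (i + 1))) ∧
    (∀ (Q : Type u) [AddCommGroup Q] [Module A Q],
      Module.Finite A Q → Module.Projective A Q →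
        ∀ i, Function.Exact
          (fun h : P (i + 1 + 1) →ₗ[A] Q => h ∘ₗ d (i + 1))
          (fun h : P (i + 1) →ₗ[A] Q => h ∘ₗ d i)) ∧
    Nonempty (G ≃ₗ[A] LinearMap.ker (d 0))

/-- `A` is of finite CM-type: there are only finitely many isomorphism classes of indecomposable
finitely generated Gorenstein-projective `A`-modules. -/
def IsFiniteCMType : Prop :=
  FinitelyManyIsoClasses A fun G => IsIndecomposable A G ∧ IsGorensteinProjective A G

/-- `E₁, …, Eₙ` are, up to isomorphism and without repetition, all the indecomposable finitely
generated Gorenstein-projective `A`-modules. -/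
structure IsCompleteGprojList {n : ℕ} (E : Fin n → Type u)
    [∀ i, AddCommGroup (E i)] [∀ i, Module A (E i)] : Prop where
  indecomposable : ∀ i, IsIndecomposable A (E i)
  gorensteinProjective : ∀ i, IsGorensteinProjective A (E i)
  nonisomorphic : ∀ i j, Nonempty (E i ≃ₗ[A] E j) → i = j
  complete : ∀ (G : Type u) [AddCommGroup G] [Module A G],
    IsIndecomposable A G → IsGorensteinProjective A G → ∃ i, Nonempty (G ≃ₗ[A] E i)

variable {A}

/-- A `G`-epimorphism: an epimorphism `g : Y → Z` such that `Hom_A(G, g)` is surjective for every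
Gorenstein-projective `G`. -/
def IsGEpi {Y Z : Type u} [AddCommGroup Y] [Module A Y] [AddCommGroup Z] [Module A Z]
    (g : Y →ₗ[A] Z) : Prop :=
  Function.Surjective g ∧
    ∀ (G : Type u) [AddCommGroup G] [Module A G], IsGorensteinProjective A G →
      Function.Surjective (fun h : G →ₗ[A] Y => g ∘ₗ h)

/-- `0 → X --f--> Y --g--> Z → 0` is a `G`-exact sequence: it is exact and remains exact under
`Hom_A(G, -)` for every Gorenstein-projective `G` (by left exactness of `Hom` it suffices to
require that `g` be a `G`-epimorphism). -/
def IsGExact {X Y Z : Type u} [AddCommGroup X] [Module A X] [AddCommGroup Y] [Module A Y]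
    [AddCommGroup Z] [Module A Z] (f : X →ₗ[A] Y) (g : Y →ₗ[A] Z) : Prop :=
  Function.Injective f ∧ Function.Exact f g ∧ IsGEpi g

/-- `G₁ --θ--> G₀ --π--> M → 0` is a proper Gorenstein-projective presentation of `M`. -/
structure IsProperGprojPresentation {G₁ G₀ M : Type u}
    [AddCommGroup G₁] [Module A G₁] [AddCommGroup G₀] [Module A G₀] [AddCommGroup M] [Module A M]
    (θ : G₁ →ₗ[A] G₀) (π : G₀ →ₗ[A] M) : Prop where
  gorensteinProjective₁ : IsGorensteinProjective A G₁
  gorensteinProjective₀ : IsGorensteinProjective A G₀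
  exact : Function.Exact θ π
  surjective : Function.Surjective π
  hom_exact : ∀ (G : Type u) [AddCommGroup G] [Module A G], IsGorensteinProjective A G →
    Function.Exact (fun h : G →ₗ[A] G₁ => θ ∘ₗ h) (fun h : G →ₗ[A] G₀ => π ∘ₗ h)
  hom_surjective : ∀ (G : Type u) [AddCommGroup G] [Module A G], IsGorensteinProjective A G →
    Function.Surjective (fun h : G →ₗ[A] G₀ => π ∘ₗ h)

/-- A minimal proper Gorenstein-projective presentation: in addition `G₀ → M` and `G₁ → Im θ`
(which are right approximations by Gorenstein-projective modules because the presentation is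
proper) are right minimal. -/
structure IsMinimalProperGprojPresentation {G₁ G₀ M : Type u}
    [AddCommGroup G₁] [Module A G₁] [AddCommGroup G₀] [Module A G₀] [AddCommGroup M] [Module A M]
    (θ : G₁ →ₗ[A] G₀) (π : G₀ →ₗ[A] M) : Prop
    extends IsProperGprojPresentation θ π where
  minimal₀ : IsRightMinimal π
  minimal₁ : IsRightMinimal θ.rangeRestrict

/-! ## Partial Gorenstein silting modules -/

/-- The class `D_θ` of all (not necessarily finitely generated) modules `X` for which
`Hom_A(θ, X)` is surjective. -/
def classD {G₁ G₀ : Type u} [AddCommGroup G₁] [Module A G₁] [AddCommGroup G₀] [Module A G₀]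
    (θ : G₁ →ₗ[A] G₀) : Set (ModuleCat.{u} A) :=
  {X | Function.Surjective (fun h : G₀ →ₗ[A] X => h ∘ₗ θ)}

/-- A relative torsion class: a class of modules closed under `G`-epimorphic images,
`G`-extensions and coproducts. -/
structure IsRelativeTorsionClass (D : Set (ModuleCat.{u} A)) : Prop where
  image : ∀ (X Y : ModuleCat.{u} A) (g : X →ₗ[A] Y), IsGEpi g → X ∈ D → Y ∈ D
  extension : ∀ (X Y Z : ModuleCat.{u} A) (f : X →ₗ[A] Y) (g : Y →ₗ[A] Z),
    IsGExact f g → X ∈ D → Z ∈ D → Y ∈ D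
  coproduct : ∀ (I : Type u) (X : I → ModuleCat.{u} A), (∀ i, X i ∈ D) →
    ModuleCat.of A (⨁ i, X i) ∈ D

/-- `T` is partial Gorenstein silting: for some proper Gorenstein-projective presentation `θ` of
`T` the class `D_θ` is a relative torsion class and contains `T`. -/
def IsPartialGorensteinSilting (A : Type u) [Ring A] (T : Type u) [AddCommGroup T] [Module A T] :
    Prop :=
  ∃ (G₁ G₀ : ModuleCat.{u} A) (θ : G₁ →ₗ[A] G₀) (π : G₀ →ₗ[A] T),
    IsProperGprojPresentation θ π ∧ IsRelativeTorsionClass (classD θ) ∧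
      ModuleCat.of A T ∈ classD θ

end GorensteinProjective

/-! ## Hom modules, the duality, transposes and translates -/

section Translate

/-- For an `S`-`Λ`-bimodule `X` and an `S`-module `Y`, the abelian group `Hom_S(X, Y)`, regarded
as a left `Λ`-module through `(l • f) x = f (x l)`. Right `Λ`-modules are modules over `Λᵐᵒᵖ`. -/
def LeftHom (S Λ X Y : Type*) [Ring S] [Ring Λ] [AddCommGroup X] [Module S X] [Module Λᵐᵒᵖ X]
    [AddCommGroup Y] [Module S Y] : Type _ :=
  X →ₗ[S] Y

section LeftHom

variable (S Λ X Y : Type*) [Ring S] [Ring Λ] [AddCommGroup X] [Module S X] [Module Λᵐᵒᵖ X]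
  [AddCommGroup Y] [Module S Y]

instance : AddCommGroup (LeftHom S Λ X Y) := inferInstanceAs (AddCommGroup (X →ₗ[S] Y))

variable [SMulCommClass S Λᵐᵒᵖ X]

instance : Module Λ (LeftHom S Λ X Y) where
  smul l f :=
    ({ toFun := fun x => (show X →ₗ[S] Y from f) (MulOpposite.op l • x)
       map_add' := fun x y => by rw [smul_add, map_add]
       map_smul' := fun s x => by rw [← smul_comm, map_smul, RingHom.id_apply] } : X →ₗ[S] Y)
  one_smul f := LinearMap.ext fun x => by
    change (show X →ₗ[S] Y from f) (MulOpposite.op 1 • x) = (show X →ₗ[S] Y from f) x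
    rw [MulOpposite.op_one, one_smul]
  mul_smul a b f := LinearMap.ext fun x => by
    change (show X →ₗ[S] Y from f) (MulOpposite.op (a * b) • x) =
      (show X →ₗ[S] Y from f) (MulOpposite.op b • MulOpposite.op a • x)
    rw [MulOpposite.op_mul, mul_smul]
  smul_zero _ := LinearMap.ext fun _ => rfl
  smul_add _ _ _ := LinearMap.ext fun _ => rfl
  add_smul a b f := LinearMap.ext fun x => by
    change (show X →ₗ[S] Y from f) (MulOpposite.op (a + b) • x) =
      (show X →ₗ[S] Y from f) (MulOpposite.op a • x) +
        (show X →ₗ[S] Y from f) (MulOpposite.op b • x)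
    rw [MulOpposite.op_add, add_smul, map_add]
  zero_smul f := LinearMap.ext fun x => by
    change (show X →ₗ[S] Y from f) (MulOpposite.op 0 • x) = 0
    rw [MulOpposite.op_zero, zero_smul, map_zero]

end LeftHom

/-- For an `A`-`Λ`-bimodule `E` and `f : G₁ → G₀`, the cokernel of the map of right `Λ`-modules
`Hom_A(f, E) : Hom_A(G₀, E) → Hom_A(G₁, E)`. -/
abbrev Transpose {A : Type*} (Λ : Type*) (E : Type*) {G₁ G₀ : Type*} [Ring A] [Ring Λ]
    [AddCommGroup E] [Module A E] [Module Λᵐᵒᵖ E] [SMulCommClass A Λᵐᵒᵖ E]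
    [AddCommGroup G₁] [Module A G₁] [AddCommGroup G₀] [Module A G₀] (f : G₁ →ₗ[A] G₀) : Type _ :=
  (G₁ →ₗ[A] E) ⧸ LinearMap.range (LinearMap.lcomp Λᵐᵒᵖ E f)

/-- The left `Λ`-module `D X = Hom_k(X, J)` dual to a right `Λ`-module `X`, for a `k`-algebra `Λ`;
here `J` is the injective envelope of `k / rad k`. -/
abbrev Dual (k J Λ X : Type*) [CommRing k] [Ring Λ] [AddCommGroup J] [Module k J]
    [AddCommGroup X] [Module k X] [Module Λᵐᵒᵖ X] : Type _ :=
  LeftHom k Λ X J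

/-- The left `Λ`-module `D (Coker Hom_A(f, E))`. If `f` is a minimal projective presentation of a
`Λ`-module and `E = Λ`, this is its Auslander–Reiten translate; if `f` is a minimal proper
Gorenstein-projective presentation of an `A`-module and `E` is the Gorenstein-projective generator,
it is its relative translate. -/
abbrev Translate (k J : Type*) {A : Type*} (Λ : Type*) (E : Type*) {G₁ G₀ : Type*}
    [CommRing k] [AddCommGroup J] [Module k J] [Ring A] [Ring Λ] [Algebra k Λ]
    [AddCommGroup E] [Module A E] [Module Λᵐᵒᵖ E] [Module k E]
    [SMulCommClass A Λᵐᵒᵖ E] [SMulCommClass A k E] [IsScalarTower k Λᵐᵒᵖ E]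
    [AddCommGroup G₁] [Module A G₁] [AddCommGroup G₀] [Module A G₀] (f : G₁ →ₗ[A] G₀) : Type _ :=
  Dual k J Λ (Transpose Λ E f)

end Translate

/-! ## Ordinary τ-rigid modules -/

section TauRigid

variable (k : Type v) [CommRing k] (J : Type v) [AddCommGroup J] [Module k J]
  (Λ : Type u) [Ring Λ] [Algebra k Λ]

/-- `N` is `τ`-rigid: `Hom_Λ(N, τ N) = 0`, where `τ N = D Tr N` is computed from a minimal
projective presentation of `N` (which is unique up to isomorphism). -/
def IsTauRigid (N : Type u) [AddCommGroup N] [Module Λ N] : Prop :=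
  ∃ (P₁ P₀ : ModuleCat.{u} Λ) (σ : P₁ →ₗ[Λ] P₀) (π : P₀ →ₗ[Λ] N),
    IsMinimalProjectivePresentation σ π ∧
      ∀ h : N →ₗ[Λ] Translate k J Λ Λ σ, h = 0

/-- `Λ` is `τ`-tilting finite: there are only finitely many isomorphism classes of indecomposable
(finitely generated) `τ`-rigid `Λ`-modules. -/
def IsTauTiltingFinite : Prop :=
  FinitelyManyIsoClasses Λ fun N =>
    Module.Finite Λ N ∧ IsIndecomposable Λ N ∧ IsTauRigid k J Λ N

end TauRigid

/-! ## The CM-Auslander algebra and `τ_G`-rigid modules -/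

section TauGRigid

/-- The algebra `End_A(E)ᵒᵖ`; it is the CM-Auslander algebra of `A` when `E` is the direct sum of a
complete list of the indecomposable finitely generated Gorenstein-projective `A`-modules. -/
def CMAuslander (A E : Type*) [Ring A] [AddCommGroup E] [Module A E] : Type _ :=
  (Module.End A E)ᵐᵒᵖ

section CMAuslander

variable (A E : Type*) [Ring A] [AddCommGroup E] [Module A E]

instance : Ring (CMAuslander A E) := inferInstanceAs (Ring (Module.End A E)ᵐᵒᵖ)

instance (k : Type*) [CommRing k] [Module k E] [SMulCommClass A k E] [Algebra k A]
    [IsScalarTower k A E] : Algebra k (CMAuslander A E) :=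
  inferInstanceAs (Algebra k (Module.End A E)ᵐᵒᵖ)

/-- The right action `e · b = b(e)` of `End_A(E)ᵒᵖ` on `E`. -/
instance : Module (CMAuslander A E)ᵐᵒᵖ E :=
  Module.compHom E (RingEquiv.opOp (Module.End A E)).symm.toRingHom

theorem op_smul_eq (b : Module.End A E) (e : E) :
    (MulOpposite.op (show CMAuslander A E from MulOpposite.op b)) • e = b e := rfl

instance : SMulCommClass A (CMAuslander A E)ᵐᵒᵖ E where
  smul_comm a b e := by
    induction b with | _ b => exact ((show (Module.End A E)ᵐᵒᵖ from b).unop.map_smul a e).symm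

instance (k : Type*) [CommRing k] [Module k E] [SMulCommClass A k E] [Algebra k A]
    [IsScalarTower k A E] : IsScalarTower k (CMAuslander A E)ᵐᵒᵖ E where
  smul_assoc _ _ _ := rfl

end CMAuslander

variable (k : Type v) [CommRing k] (J : Type v) [AddCommGroup J] [Module k J]
  (A : Type u) [Ring A] [Algebra k A]
  (E : Type u) [AddCommGroup E] [Module A E] [Module k E] [IsScalarTower k A E]

/-- `M` is `τ_G`-rigid: `Hom((E, M), τ_G M) = 0` over the CM-Auslander algebra `Λ = End_A(E)ᵒᵖ`,
where `(E, M) = Hom_A(E, M)` is a left `Λ`-module and `τ_G M = D Tr_G M` is computed from a minimal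
proper Gorenstein-projective presentation of `M` (which is unique up to isomorphism). -/
def IsTauGRigid (M : Type u) [AddCommGroup M] [Module A M] : Prop :=
  ∃ (G₁ G₀ : ModuleCat.{u} A) (θ : G₁ →ₗ[A] G₀) (π : G₀ →ₗ[A] M),
    IsMinimalProperGprojPresentation θ π ∧
      ∀ h : LeftHom A (CMAuslander A E) E M →ₗ[CMAuslander A E]
        Translate k J (CMAuslander A E) E θ, h = 0

/-- `A` is `τ_G`-tilting finite: there are only finitely many isomorphism classes of indecomposable
(finitely generated) `τ_G`-rigid `A`-modules. -/
def IsTauGTiltingFinite : Prop :=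
  FinitelyManyIsoClasses A fun M =>
    Module.Finite A M ∧ IsIndecomposable A M ∧ IsTauGRigid k J A E M

end TauGRigid

end GorensteinSilting

namespace GorensteinSilting

/-! Write `Λ` for the CM-Auslander algebra and consider the functor `Hom_A(E, -)` to `Λ`-modules.
Summands of Gorenstein-projectives are Gorenstein-projective, so over the Artinian ring `A` every
Gorenstein-projective lies in `add E` (`IsCompleteGprojList.inAdd`); in particular `A` does. Hence
the functor is faithful, it sends Gorenstein-projectives to finitely generated projectives, and it
turns proper Gorenstein-projective presentations into projective presentations, preserving
minimality. On modules with such a presentation it is also full, so it preserves indecomposability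
and reflects isomorphism.

It remains to see that both kinds of modules become τ-rigid. For a τ_G-rigid `M`, the translate of
`Hom_A(E, M)` embeds in `τ_G M` (`EHom.exists_translate_injective`), so maps into it vanish too. For
a partial Gorenstein silting `T`, `T ∈ D_θ` says that every map `G₁ → T` extends along `θ`. By
fullness the same holds for `Hom_A(E, θ)`, then for the minimal projective presentation
(`IsMinimalProjectivePresentation.extend`), and this forces `Hom(N, τN) = 0` for `N = Hom_A(E, T)`
(`hom_translate_eq_zero`). Finiteness over `Λ` therefore pulls back along the functor. -/

/-- A linear map that vanishes on the kernel of a surjective linear map factors through it. -/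
theorem exists_comp_eq_of_ker_le {R X Y Z : Type*} [Ring R] [AddCommGroup X] [Module R X]
    [AddCommGroup Y] [Module R Y] [AddCommGroup Z] [Module R Z] {g : X →ₗ[R] Y} {h : X →ₗ[R] Z}
    (hg : Function.Surjective g) (hgh : LinearMap.ker g ≤ LinearMap.ker h) :
    ∃ t : Y →ₗ[R] Z, t ∘ₗ g = h := by
  refine ⟨(LinearMap.ker g).liftQ _ hgh ∘ₗ (g.quotKerEquivOfSurjective hg).symm.toLinearMap,
    LinearMap.ext fun x => ?_⟩
  have : (g.quotKerEquivOfSurjective hg).symm (g x) = (LinearMap.ker g).mkQ x := by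
    rw [LinearEquiv.symm_apply_eq]; rfl
  simp [this]

/-! ### Direct summands of Gorenstein-projective modules -/

section GprojSummands

variable {A : Type u} [Ring A]

/-- `X` is isomorphic to a direct summand of `Y`. -/
def IsSummand (A : Type u) [Ring A] (X Y : Type u) [AddCommGroup X] [Module A X] [AddCommGroup Y]
    [Module A Y] : Prop :=
  ∃ (s : X →ₗ[A] Y) (r : Y →ₗ[A] X), r ∘ₗ s = LinearMap.id

/-- Each map from `X` to a finitely generated projective module extends along `i`. -/
def IsLeftProjApprox {X P : Type u} [AddCommGroup X] [Module A X] [AddCommGroup P] [Module A P]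
    (i : X →ₗ[A] P) : Prop :=
  ∀ (Q : Type u) [AddCommGroup Q] [Module A Q], Module.Finite A Q → Module.Projective A Q →
    ∀ h : X →ₗ[A] Q, ∃ H : P →ₗ[A] Q, H ∘ₗ i = h

/-- There is an exact sequence `0 → X → P → Y → 0` with `P` finitely generated projective that
stays exact under homomorphisms to finitely generated projective modules. -/
def IsCosyzygy (A : Type u) [Ring A] (X Y : Type u) [AddCommGroup X] [Module A X] [AddCommGroup Y]
    [Module A Y] : Prop :=
  ∃ (P : ModuleCat.{u} A) (f : X →ₗ[A] P) (g : P →ₗ[A] Y),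
    Module.Finite A P ∧ Module.Projective A P ∧ Function.Injective f ∧ Function.Exact f g ∧
      Function.Surjective g ∧ IsLeftProjApprox f

variable {X Y K G C Q : Type u} [AddCommGroup X] [Module A X] [AddCommGroup Y] [Module A Y]
  [AddCommGroup G] [Module A G] [AddCommGroup C] [Module A C] [AddCommGroup Q] [Module A Q]
  [AddCommGroup K] [Module A K]

theorem IsCosyzygy.prod_left (h : IsCosyzygy A G C) [Module.Finite A Q] [Module.Projective A Q] :
    IsCosyzygy A (G × Q) C := by
  obtain ⟨P, f, g, hfin, hproj, hf, hfg, hg, happ⟩ := h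
  refine ⟨ModuleCat.of A (P × Q), f.prodMap LinearMap.id, g ∘ₗ LinearMap.fst A P Q,
    inferInstanceAs (Module.Finite A (P × Q)), inferInstanceAs (Module.Projective A (P × Q)),
    hf.prodMap Function.injective_id, ?_, hg.comp Prod.fst_surjective, ?_⟩
  · rintro ⟨p, q⟩
    constructor
    · intro h
      obtain ⟨x, rfl⟩ := (hfg p).1 h
      exact ⟨(x, q), rfl⟩
    · rintro ⟨⟨x, q'⟩, h⟩
      obtain ⟨rfl, rfl⟩ := Prod.ext_iff.1 h
      exact (hfg _).2 ⟨x, rfl⟩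
  · intro Q' _ _ h1 h2 h
    obtain ⟨H, hH⟩ := happ Q' h1 h2 (h ∘ₗ LinearMap.inl A G Q)
    refine ⟨H.coprod (h ∘ₗ LinearMap.inr A G Q), LinearMap.ext fun x => ?_⟩
    have := LinearMap.congr_fun hH x.1
    simp only [LinearMap.comp_apply] at this
    simp [this, ← map_add]

theorem IsCosyzygy.prod_right (h : IsCosyzygy A K G) [Module.Finite A Q] [Module.Projective A Q] :
    IsCosyzygy A K (G × Q) := by
  obtain ⟨P, f, g, hfin, hproj, hf, hfg, hg, happ⟩ := h
  refine ⟨ModuleCat.of A (P × Q), LinearMap.inl A P Q ∘ₗ f, g.prodMap LinearMap.id,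
    inferInstanceAs (Module.Finite A (P × Q)), inferInstanceAs (Module.Projective A (P × Q)),
    LinearMap.inl_injective.comp hf, ?_, hg.prodMap Function.surjective_id, ?_⟩
  · rintro ⟨p, q⟩
    constructor
    · intro h
      obtain ⟨h1, rfl⟩ := Prod.ext_iff.1 h
      obtain ⟨x, rfl⟩ := (hfg p).1 h1
      exact ⟨x, rfl⟩
    · rintro ⟨x, h⟩
      obtain ⟨rfl, rfl⟩ := Prod.ext_iff.1 h
      exact Prod.ext ((hfg _).2 ⟨x, rfl⟩) rfl
  · intro Q' _ _ h1 h2 h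
    obtain ⟨H, hH⟩ := happ Q' h1 h2 h
    exact ⟨H ∘ₗ LinearMap.fst A P Q, hH⟩

/-- The idempotent of `G` cutting out `X` extends to an endomorphism `ε` of `P`, which need not be
idempotent. This is why the cokernel of `X → P` is a summand only of `C × P`: embed by `p ↦ (g p, p
- ε p)` and return by `(g p, p') ↦ [ε p + p']`. -/
theorem IsCosyzygy.exists_of_isSummand_left (h : IsCosyzygy A G C) (hX : IsSummand A X G) :
    ∃ Y P : ModuleCat.{u} A, Module.Finite A P ∧ Module.Projective A P ∧
      IsSummand A Y (C × P) ∧ IsCosyzygy A X Y := by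
  obtain ⟨P, f, g, hfin, hproj, hf, hfg, hg, happ⟩ := h
  obtain ⟨s, r, hrs⟩ := hX
  replace hrs : ∀ x, r (s x) = x := LinearMap.congr_fun hrs
  obtain ⟨ε, hε⟩ := happ P hfin hproj (f ∘ₗ s ∘ₗ r)
  replace hε : ∀ x, ε (f x) = f (s (r x)) := LinearMap.congr_fun hε
  let N := LinearMap.range (f ∘ₗ s)
  have hker : LinearMap.ker g ≤ LinearMap.ker (N.mkQ ∘ₗ ε) := by
    intro p hp
    obtain ⟨x, rfl⟩ := (hfg p).1 hp
    simp only [LinearMap.mem_ker, LinearMap.comp_apply, hε, Submodule.mkQ_apply,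
      Submodule.Quotient.mk_eq_zero]
    exact ⟨r x, rfl⟩
  obtain ⟨t, ht⟩ := exists_comp_eq_of_ker_le hg hker
  replace ht : ∀ p, t (g p) = N.mkQ (ε p) := LinearMap.congr_fun ht
  have hN : N ≤ LinearMap.ker (g.prod (LinearMap.id - ε)) := by
    rintro _ ⟨x, rfl⟩
    have : g (f (s x)) = 0 := (hfg _).2 ⟨s x, rfl⟩
    simp [hε, hrs, this]
  refine ⟨ModuleCat.of A (P ⧸ N), P, hfin, hproj,
    ⟨N.liftQ _ hN, t.coprod N.mkQ, ?_⟩, P, f ∘ₗ s, N.mkQ, hfin, hproj,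
    hf.comp (Function.LeftInverse.injective hrs), ?_, N.mkQ_surjective, ?_⟩
  · refine LinearMap.ext fun y => ?_
    obtain ⟨p, rfl⟩ := N.mkQ_surjective y
    change t (g p) + N.mkQ (p - ε p) = N.mkQ p
    rw [ht, ← map_add, add_sub_cancel]
  · intro p
    exact Submodule.Quotient.mk_eq_zero N
  · intro Q' _ _ h1 h2 h
    obtain ⟨H, hH⟩ := happ Q' h1 h2 (h ∘ₗ r)
    refine ⟨H, LinearMap.ext fun x => ?_⟩
    exact (LinearMap.congr_fun hH (s x)).trans (congrArg h (hrs x))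

/-- Dual argument: the idempotent of `G` lifts to an endomorphism `ε` of the projective `P`, and `Y`
is the kernel of `P → G → X`. On it `ε` takes values in `K`, so `x ↦ (ε x, x)` embeds it in `K × P`,
with retraction `(y, p) ↦ f y + p - ε p`. -/
theorem IsCosyzygy.exists_of_isSummand_right (h : IsCosyzygy A K G) (hX : IsSummand A X G) :
    ∃ Y P : ModuleCat.{u} A, Module.Finite A P ∧ Module.Projective A P ∧
      IsSummand A Y (K × P) ∧ IsCosyzygy A Y X := by
  obtain ⟨P, f, g, hfin, hproj, hf, hfg, hg, happ⟩ := h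
  obtain ⟨s, r, hrs⟩ := hX
  replace hrs : ∀ x, r (s x) = x := LinearMap.congr_fun hrs
  obtain ⟨ε, hε⟩ := Module.projective_lifting_property g (s ∘ₗ r ∘ₗ g) hg
  replace hε : ∀ x, g (ε x) = s (r (g x)) := LinearMap.congr_fun hε
  let N := LinearMap.ker (r ∘ₗ g)
  have hN : ∀ x : N, r (g x) = 0 := fun x => x.2
  let e := LinearEquiv.ofInjective f hf
  have hfe : ∀ y : LinearMap.range f, f (e.symm y) = y := fun y =>
    congrArg Subtype.val (e.apply_symm_apply y)
  let a : N →ₗ[A] K := e.symm.toLinearMap ∘ₗ (ε ∘ₗ N.subtype).codRestrict (LinearMap.range f)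
    fun x => (hfg _).1 (by simp [hε, hN])
  have ha : ∀ x : N, f (a x) = ε x := fun x => hfe _
  let b : K →ₗ[A] N := f.codRestrict N fun x => by
    have : g (f x) = 0 := (hfg _).2 ⟨x, rfl⟩
    simp [N, this]
  let c : P →ₗ[A] N := (LinearMap.id - ε).codRestrict N fun x => by
    simp [N, hε, hrs]
  refine ⟨ModuleCat.of A N, P, hfin, hproj, ⟨a.prod N.subtype, b.coprod c, ?_⟩, P, N.subtype,
    r ∘ₗ g, hfin, hproj, N.injective_subtype, ?_,
    (Function.LeftInverse.surjective hrs).comp hg, ?_⟩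
  · refine LinearMap.ext fun x => Subtype.ext ?_
    change f (a x) + (x.1 - ε x.1) = x.1
    rw [ha, add_sub_cancel]
  · intro p
    exact ⟨fun hp => ⟨⟨p, hp⟩, rfl⟩, fun ⟨x, hx⟩ => hx ▸ x.2⟩
  · intro Q' _ _ h1 h2 h
    obtain ⟨H, hH⟩ := happ Q' h1 h2 (h ∘ₗ b)
    -- On `N` the identity splits as `(id - ε) + ε`: the first part already maps `P` to `N`, the
    -- second passes through `K`, where the approximation property applies.
    refine ⟨h ∘ₗ c + H ∘ₗ ε, LinearMap.ext fun x => ?_⟩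
    have h3 := LinearMap.congr_fun hH (a x)
    simp only [LinearMap.comp_apply] at h3
    change h (c x) + H (ε x) = h x
    rw [← ha, h3, ← map_add]
    congr 1
    refine Subtype.ext ?_
    change (x.1 - ε x.1) + f (a x) = x.1
    rw [ha, sub_add_cancel]

theorem exists_int_chain {α : Type*} {r : α → α → Prop} (hright : ∀ x, ∃ y, r x y)
    (hleft : ∀ x, ∃ y, r y x) (x : α) :
    ∃ f : ℤ → α, f 0 = x ∧ ∀ n, r (f n) (f (n + 1)) := by
  choose R hR using hright
  choose L hL using hleft
  -- `Int.negSucc m` is `-(m + 1)`, hence the exponent `m + 1` on the left branch.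
  refine ⟨fun n => Int.casesOn n (fun m => R^[m] x) (fun m => L^[m + 1] x), rfl, ?_⟩
  rintro (n | _ | n)
  · change r (R^[n] x) (R^[n + 1] x)
    rw [Function.iterate_succ_apply']
    exact hR _
  · exact hL x
  · change r (L^[n + 2] x) (L^[n + 1] x)
    rw [Function.iterate_succ_apply' _ (n + 1)]
    exact hL _

/-- A class of modules that is closed under forming syzygies and cosyzygies in suitable sequences
consists of Gorenstein-projective modules. -/
theorem isGorensteinProjective_of_cosyzygies (S : ModuleCat.{u} A → Prop)
    (hright : ∀ X, S X → ∃ Y : ModuleCat.{u} A, S Y ∧ IsCosyzygy A X Y)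
    (hleft : ∀ X, S X → ∃ Y : ModuleCat.{u} A, S Y ∧ IsCosyzygy A Y X)
    (X : ModuleCat.{u} A) (hX : S X) : IsGorensteinProjective A X := by
  obtain ⟨F, hF0, hF⟩ := exists_int_chain (α := {X // S X})
    (r := fun X Y => IsCosyzygy A X.1 Y.1)
    (fun X => let ⟨Y, h1, h2⟩ := hright X.1 X.2; ⟨⟨Y, h1⟩, h2⟩)
    (fun X => let ⟨Y, h1, h2⟩ := hleft X.1 X.2; ⟨⟨Y, h1⟩, h2⟩) ⟨X, hX⟩
  choose P f g hfin hproj hf hfg hg happ using hF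
  -- The short exact sequences `F i → P i → F (i + 1)` are spliced, so the differential is `P i → F
  -- (i + 1) → P (i + 1)`.
  have hd : ∀ i (x : P i), g (i + 1) ((f (i + 1) ∘ₗ g i) x) = 0 := fun i x =>
    (hfg (i + 1) _).2 ⟨g i x, rfl⟩
  refine ⟨P, fun i => f (i + 1) ∘ₗ g i, fun i => ⟨hfin i, hproj i⟩, ?_, ?_, ?_⟩
  · intro i x
    constructor
    · intro hx
      have hx : g (i + 1) x = 0 := hf _ (hx.trans (map_zero _).symm)
      obtain ⟨y, rfl⟩ := (hfg _ _).1 hx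
      obtain ⟨z, rfl⟩ := hg i y
      exact ⟨z, rfl⟩
    · rintro ⟨y, rfl⟩
      exact (congrArg (f (i + 1 + 1)) (hd i y)).trans (map_zero _)
  · intro Q _ _ h1 h2 i h
    constructor
    · intro hh
      have hh : h ∘ₗ f (i + 1) = 0 := by
        refine LinearMap.ext fun x => ?_
        obtain ⟨y, rfl⟩ := hg i x
        exact LinearMap.congr_fun hh y
      have hker : LinearMap.ker (g (i + 1)) ≤ LinearMap.ker h := by
        intro p hp
        obtain ⟨x, rfl⟩ := (hfg _ p).1 hp
        exact LinearMap.congr_fun hh x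
      obtain ⟨t, ht⟩ := exists_comp_eq_of_ker_le (hg (i + 1)) hker
      obtain ⟨H, hH⟩ := happ (i + 1 + 1) Q h1 h2 t
      exact ⟨H, LinearMap.ext fun p => (LinearMap.congr_fun hH _).trans (LinearMap.congr_fun ht p)⟩
    · rintro ⟨H, rfl⟩
      refine LinearMap.ext fun x => ?_
      change H (f (i + 1 + 1) (g (i + 1) ((f (i + 1) ∘ₗ g i) x))) = 0
      rw [hd, map_zero, map_zero]
  · have hker : LinearMap.ker (f (0 + 1) ∘ₗ g 0) = LinearMap.range (f 0) := by
      rw [LinearMap.ker_comp, LinearMap.ker_eq_bot.2 (hf _), Submodule.comap_bot]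
      exact (hfg 0).linearMap_ker_eq
    have e : (F 0).1 ≃ₗ[A] LinearMap.ker (f (0 + 1) ∘ₗ g 0) :=
      (LinearEquiv.ofInjective (f 0) (hf 0)).trans (LinearEquiv.ofEq _ _ hker.symm)
    rw [hF0] at e
    exact ⟨e⟩

/-- The exactness conditions on a complex in the definition of a Gorenstein-projective module. -/
structure IsTotallyAcyclic (P : ℤ → ModuleCat.{u} A) (d : ∀ i : ℤ, P i →ₗ[A] P (i + 1)) :
    Prop where
  proj : ∀ i, Module.Finite A (P i) ∧ Module.Projective A (P i)
  exact : ∀ i, Function.Exact (d i) (d (i + 1))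
  hom_exact : ∀ (Q : Type u) [AddCommGroup Q] [Module A Q],
    Module.Finite A Q → Module.Projective A Q →
      ∀ i, Function.Exact
        (fun h : P (i + 1 + 1) →ₗ[A] Q => h ∘ₗ d (i + 1))
        (fun h : P (i + 1) →ₗ[A] Q => h ∘ₗ d i)

theorem IsTotallyAcyclic.isCosyzygy_ker {P : ℤ → ModuleCat.{u} A}
    {d : ∀ i : ℤ, P i →ₗ[A] P (i + 1)} (h : IsTotallyAcyclic P d) (n : ℤ) :
    IsCosyzygy A (LinearMap.ker (d n)) (LinearMap.ker (d (n + 1))) := by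
  refine ⟨P n, (LinearMap.ker (d n)).subtype, (d n).codRestrict _ fun x =>
    (h.exact n _).2 ⟨x, rfl⟩, (h.proj n).1, (h.proj n).2, Submodule.injective_subtype _, ?_, ?_, ?_⟩
  · intro x
    rw [Subtype.ext_iff]
    exact ⟨fun hx => ⟨⟨x, hx⟩, rfl⟩, fun ⟨y, hy⟩ => hy ▸ y.2⟩
  · rintro ⟨x, hx⟩
    obtain ⟨y, rfl⟩ := (h.exact n x).1 hx
    exact ⟨y, rfl⟩
  · intro Q _ _ h1 h2 t
    -- To extend `t` to `P (m + 2)`, pull it back to `P (m + 1)`; the result kills the image of `d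
    -- m`, so it factors through `d (m + 1)` by `hom_exact` at `m`.
    obtain ⟨m, rfl⟩ : ∃ m, n = m + 1 + 1 := ⟨n - 2, by ring⟩
    have hd (x) : d (m + 1 + 1) (d (m + 1) x) = 0 := (h.exact _ _).2 ⟨x, rfl⟩
    let c := (d (m + 1)).codRestrict (LinearMap.ker (d (m + 1 + 1))) hd
    obtain ⟨H, hH⟩ := (h.hom_exact Q h1 h2 m (t ∘ₗ c)).1 <| LinearMap.ext fun x => by
      have : c (d m x) = 0 := Subtype.ext ((h.exact m _).2 ⟨x, rfl⟩)
      simp [this]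
    refine ⟨H, LinearMap.ext fun ⟨x, hx⟩ => ?_⟩
    obtain ⟨y, rfl⟩ := (h.exact (m + 1) x).1 hx
    exact LinearMap.congr_fun hH y

/-- Direct summands of a Gorenstein-projective module plus a finitely generated projective module
are Gorenstein-projective. -/
theorem isGorensteinProjective_of_isSummand_prod (hG : IsGorensteinProjective A G)
    (hQ : Module.Finite A Q) (hQ' : Module.Projective A Q) (hX : IsSummand A X (G × Q)) :
    IsGorensteinProjective A X := by
  obtain ⟨P, d, h1, h2, h3, ⟨e⟩⟩ := hG
  have hP : IsTotallyAcyclic P d := ⟨h1, h2, h3⟩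
  -- Summands of cocycle modules alone need not be stable under the two constructions above, since
  -- each adds a projective; allowing a projective factor makes the class closed in both directions.
  refine isGorensteinProjective_of_cosyzygies (fun X => ∃ (n : ℤ) (Q : ModuleCat.{u} A),
    Module.Finite A Q ∧ Module.Projective A Q ∧ IsSummand A X (LinearMap.ker (d n) × Q))
    ?_ ?_ (ModuleCat.of A X) ?_
  · rintro X ⟨n, Q, hQ, hQ', hX⟩
    obtain ⟨Y, Q', hf, hp, hY, hXY⟩ :=
      ((hP.isCosyzygy_ker n).prod_left (Q := Q)).exists_of_isSummand_left hX
    exact ⟨Y, ⟨n + 1, Q', hf, hp, hY⟩, hXY⟩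
  · rintro X ⟨n, Q, hQ, hQ', hX⟩
    obtain ⟨m, rfl⟩ : ∃ m, n = m + 1 := ⟨n - 1, by ring⟩
    obtain ⟨Y, Q', hf, hp, hY, hXY⟩ :=
      ((hP.isCosyzygy_ker m).prod_right (Q := Q)).exists_of_isSummand_right hX
    exact ⟨Y, ⟨m, Q', hf, hp, hY⟩, hXY⟩
  · obtain ⟨s, r, hrs⟩ := hX
    refine ⟨0, ModuleCat.of A Q, hQ, hQ', e.toLinearMap.prodMap LinearMap.id ∘ₗ s,
      r ∘ₗ e.symm.toLinearMap.prodMap LinearMap.id, LinearMap.ext fun x => ?_⟩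
    simpa using LinearMap.congr_fun hrs x

theorem isGorensteinProjective_of_isSummand (hG : IsGorensteinProjective A G)
    (hX : IsSummand A X G) : IsGorensteinProjective A X := by
  obtain ⟨s, r, hrs⟩ := hX
  exact isGorensteinProjective_of_isSummand_prod (Q := PUnit.{u + 1}) hG inferInstance inferInstance
    ⟨LinearMap.inl A G PUnit.{u + 1} ∘ₗ s, r ∘ₗ LinearMap.fst A G PUnit.{u + 1}, hrs⟩

theorem isGorensteinProjective_of_projective [hf : Module.Finite A Q] [hp : Module.Projective A Q] :
    IsGorensteinProjective A Q := by
  refine isGorensteinProjective_of_cosyzygies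
    (fun X => Module.Finite A X ∧ Module.Projective A X) ?_ ?_ (ModuleCat.of A Q) ⟨hf, hp⟩
  · rintro X ⟨h1, h2⟩
    refine ⟨ModuleCat.of A PUnit.{u + 1}, ⟨inferInstanceAs (Module.Finite A PUnit.{u + 1}),
      inferInstanceAs (Module.Projective A PUnit.{u + 1})⟩, X, LinearMap.id, 0, h1, h2,
      Function.injective_id, fun x => ⟨fun _ => ⟨x, rfl⟩, fun _ => rfl⟩, fun _ => ⟨0, rfl⟩,
      fun Q _ _ _ _ h => ⟨h, rfl⟩⟩
  · rintro X ⟨h1, h2⟩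
    refine ⟨ModuleCat.of A PUnit.{u + 1}, ⟨inferInstanceAs (Module.Finite A PUnit.{u + 1}),
      inferInstanceAs (Module.Projective A PUnit.{u + 1})⟩, X, 0, LinearMap.id, h1, h2,
      fun _ _ _ => rfl, fun x => ⟨fun h => ⟨0, h.symm⟩, fun ⟨_, h⟩ => h.symm⟩,
      Function.surjective_id, fun Q _ _ _ _ h => ⟨0, LinearMap.ext fun x => (map_zero h).symm⟩⟩

theorem IsGorensteinProjective.finite (hG : IsGorensteinProjective A G) : Module.Finite A G := by
  obtain ⟨P, d, h1, h2, -, ⟨e⟩⟩ := hG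
  have hker : ∀ n, Module.Finite A (LinearMap.ker (d n)) := by
    intro n
    obtain ⟨m, rfl⟩ : ∃ m, n = m + 1 := ⟨n - 1, by ring⟩
    have := (h1 m).1
    rw [(h2 m).linearMap_ker_eq]
    infer_instance
  have := hker 0
  exact Module.Finite.equiv e.symm

end GprojSummands

/-! ### Gorenstein-projective modules lie in `add E` -/

section AddClosure

variable {A : Type u} [Ring A]

/-- `G` belongs to `add E`, that is, it is a direct summand of a finite direct sum of copies of
`E`; equivalently, its identity is a finite sum of endomorphisms that factor through `E`. -/
def InAdd (A : Type u) [Ring A] (E G : Type u) [AddCommGroup E] [Module A E] [AddCommGroup G]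
    [Module A G] : Prop :=
  ∃ (ι : Type) (_ : Fintype ι) (a : ι → G →ₗ[A] E) (b : ι → E →ₗ[A] G),
    ∀ x, ∑ i, b i (a i x) = x

variable {E G : Type u} [AddCommGroup E] [Module A E] [AddCommGroup G] [Module A G]

theorem InAdd.of_isCompl {p q : Submodule A G} (h : IsCompl p q) (hp : InAdd A E p)
    (hq : InAdd A E q) : InAdd A E G := by
  obtain ⟨ι, _, a, b, hab⟩ := hp
  obtain ⟨κ, _, c, d, hcd⟩ := hq
  refine ⟨ι ⊕ κ, inferInstance,
    Sum.elim (fun i => a i ∘ₗ p.projectionOnto q h) (fun i => c i ∘ₗ q.projectionOnto p h.symm),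
    Sum.elim (fun i => p.subtype ∘ₗ b i) (fun i => q.subtype ∘ₗ d i), fun x => ?_⟩
  simp only [Fintype.sum_sum_type, Sum.elim_inl, Sum.elim_inr, LinearMap.comp_apply,
    ← map_sum, hab, hcd]
  exact Submodule.projection_add_projection_eq_self h x

theorem isSummand_of_isCompl {p q : Submodule A G} (h : IsCompl p q) : IsSummand A p G :=
  ⟨p.subtype, p.projectionOnto q h, LinearMap.ext fun x => by simp⟩

/-- Over an Artinian ring, Gorenstein-projective modules are direct sums of indecomposable ones. -/
theorem IsCompleteGprojList.inAdd [IsArtinianRing A] {n : ℕ} {E : Fin n → Type u}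
    [∀ i, AddCommGroup (E i)] [∀ i, Module A (E i)] (hE : IsCompleteGprojList A E)
    (hG : IsGorensteinProjective A G) : InAdd A (∀ i, E i) G := by
  -- Induction on length: both parts of a nontrivial decomposition are strictly shorter and again
  -- Gorenstein-projective.
  suffices H : ∀ (N : ℕ∞) (G : Type u) [AddCommGroup G] [Module A G],
      IsGorensteinProjective A G → Module.length A G = N → InAdd A (∀ i, E i) G from
    H _ G hG rfl
  intro N
  induction N using WellFoundedLT.induction with | _ N ih =>
  intro G _ _ hG hN
  have := hG.finite
  by_cases hind : IsIndecomposable A G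
  · obtain ⟨i, ⟨e⟩⟩ := hE.complete G hind hG
    classical
    refine ⟨Unit, inferInstance, fun _ => LinearMap.single A E i ∘ₗ e.toLinearMap,
      fun _ => e.symm.toLinearMap ∘ₗ LinearMap.proj i, fun x => by simp⟩
  · by_cases hnt : Nontrivial G
    · simp only [IsIndecomposable, hnt, true_and, not_forall, not_or] at hind
      obtain ⟨p, q, hpq, hp, hq⟩ := hind
      refine InAdd.of_isCompl hpq
        (ih _ ?_ p (isGorensteinProjective_of_isSummand hG (isSummand_of_isCompl hpq)) rfl)
        (ih _ ?_ q (isGorensteinProjective_of_isSummand hG (isSummand_of_isCompl hpq.symm)) rfl)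
      · rw [← hN]
        refine Submodule.length_lt fun h => hq ?_
        exact disjoint_top.1 (h ▸ hpq.disjoint.symm)
      · rw [← hN]
        refine Submodule.length_lt fun h => hp ?_
        exact disjoint_top.1 (h ▸ hpq.disjoint)
    · rw [not_nontrivial_iff_subsingleton] at hnt
      exact ⟨Empty, inferInstance, Empty.elim, Empty.elim, fun _ => Subsingleton.elim _ _⟩

end AddClosure

end GorensteinSilting

namespace GorensteinSilting

/-! ### Minimal projective presentations and maps into the translate -/

section MinimalPresentation

variable {R : Type u} [Ring R] {P₁ P₀ Q₁ Q₀ N Y : Type u} [AddCommGroup P₁] [Module R P₁]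
  [AddCommGroup P₀] [Module R P₀] [AddCommGroup Q₁] [Module R Q₁] [AddCommGroup Q₀] [Module R Q₀]
  [AddCommGroup N] [Module R N] [AddCommGroup Y] [Module R Y]

theorem isRightMinimal_rangeRestrict {f : P₁ →ₗ[R] P₀} :
    IsRightMinimal f.rangeRestrict ↔ IsRightMinimal f := by
  refine forall_congr' fun φ => imp_congr_left ?_
  simp only [LinearMap.ext_iff, Subtype.ext_iff]
  rfl

/-- The projective cover of a finitely generated module over an Artinian ring. -/
theorem exists_projectiveCover [IsArtinianRing R] (N : Type u) [AddCommGroup N] [Module R N]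
    [Module.Finite R N] :
    ∃ (P : ModuleCat.{u} R) (π : P →ₗ[R] N), Module.Finite R P ∧ Module.Projective R P ∧
      Function.Surjective π ∧ IsRightMinimal π := by
  obtain ⟨m, p, hp⟩ := Module.Finite.exists_fin' R N
  suffices H : ∀ (n : ℕ∞) (P : Type u) [AddCommGroup P] [Module R P] [Module.Finite R P]
      [Module.Projective R P] (π : P →ₗ[R] N), Function.Surjective π → Module.length R P = n →
      ∃ (P : ModuleCat.{u} R) (π : P →ₗ[R] N), Module.Finite R P ∧ Module.Projective R P ∧
        Function.Surjective π ∧ IsRightMinimal π from H _ (Fin m → R) p hp rfl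
  intro n
  induction n using WellFoundedLT.induction with | _ n ih =>
  intro P _ _ _ _ π hπ hn
  by_cases hmin : IsRightMinimal π
  · exact ⟨ModuleCat.of R P, π, ‹_›, ‹_›, hπ, hmin⟩
  simp only [IsRightMinimal, not_forall] at hmin
  obtain ⟨φ, hφ, hbij⟩ := hmin
  -- Fitting's lemma: `P` is the sum of the kernel and image of `φ ^ m`. Since `π φ = π`, the image
  -- still covers `N`, and it is strictly shorter; `m ≥ 1` is needed so that surjectivity of `φ ^ m`
  -- would give that of `φ`.
  obtain ⟨m, hm, hc⟩ := ((Filter.eventually_ge_atTop 1).and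
    (LinearMap.eventually_isCompl_ker_pow_range_pow φ)).exists
  have hpow : ∀ j x, π ((φ ^ j) x) = π x := by
    intro j
    induction j with
    | zero => exact fun x => rfl
    | succ j ihj =>
      intro x
      rw [pow_succ, Module.End.mul_apply, ihj]
      exact LinearMap.congr_fun hφ x
  have hproj : Module.Projective R (LinearMap.range (φ ^ m)) :=
    Module.Projective.of_split (LinearMap.range (φ ^ m)).subtype
      (Submodule.projectionOnto _ _ hc.symm) (Submodule.projectionOnto_comp_subtype _)
  refine ih _ ?_ (LinearMap.range (φ ^ m)) (π ∘ₗ (LinearMap.range (φ ^ m)).subtype) ?_ rfl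
  · rw [← hn]
    refine Submodule.length_lt fun h => hbij ?_
    refine IsNoetherian.bijective_of_surjective_endomorphism φ fun y => ?_
    obtain ⟨x, hx⟩ := LinearMap.range_eq_top.1 h y
    obtain ⟨j, rfl⟩ := Nat.exists_eq_add_of_le' hm
    rw [pow_succ', Module.End.mul_apply] at hx
    exact ⟨_, hx⟩
  · intro y
    obtain ⟨x, rfl⟩ := hπ y
    exact ⟨⟨(φ ^ m) x, x, rfl⟩, hpow m x⟩

theorem exists_isMinimalProjectivePresentation [IsArtinianRing R] (N : Type u) [AddCommGroup N]
    [Module R N] [Module.Finite R N] :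
    ∃ (P₁ P₀ : ModuleCat.{u} R) (σ : P₁ →ₗ[R] P₀) (π : P₀ →ₗ[R] N),
      IsMinimalProjectivePresentation σ π := by
  obtain ⟨P₀, π, h1, h2, h3, h4⟩ := exists_projectiveCover (R := R) N
  obtain ⟨P₁, ρ, h5, h6, h7, h8⟩ := exists_projectiveCover (R := R) (LinearMap.ker π)
  refine ⟨P₁, P₀, (LinearMap.ker π).subtype ∘ₗ ρ, π, h5, h1, h6, h2, ?_, h3, h4,
    isRightMinimal_rangeRestrict.2 ?_⟩
  · intro x
    constructor
    · intro hx
      obtain ⟨y, hy⟩ := h7 ⟨x, hx⟩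
      exact ⟨y, congrArg Subtype.val hy⟩
    · rintro ⟨y, rfl⟩
      exact (ρ y).2
  · exact fun φ hφ => h8 φ <| LinearMap.ext fun x => Subtype.ext (LinearMap.congr_fun hφ x)

/-- If all maps to `Y` from the first term of some projective presentation extend along the
presentation, then this holds for the minimal projective presentation. -/
theorem IsMinimalProjectivePresentation.extend {σ : Q₁ →ₗ[R] Q₀} {ρ : Q₀ →ₗ[R] N}
    (hσ : IsMinimalProjectivePresentation σ ρ) {θ : P₁ →ₗ[R] P₀} {π : P₀ →ₗ[R] N}
    [Module.Projective R P₁] [Module.Projective R P₀] (hex : Function.Exact θ π)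
    (hsurj : Function.Surjective π) (hY : ∀ h : P₁ →ₗ[R] Y, ∃ g : P₀ →ₗ[R] Y, g ∘ₗ θ = h)
    (h : Q₁ →ₗ[R] Y) : ∃ g : Q₀ →ₗ[R] Y, g ∘ₗ σ = h := by
  have := hσ.projective₁
  have := hσ.projective₀
  obtain ⟨a₀, ha₀⟩ := Module.projective_lifting_property π ρ hsurj
  obtain ⟨b, hb⟩ := Module.projective_lifting_property ρ π hσ.surjective
  have hba : ρ ∘ₗ (b ∘ₗ a₀) = ρ := by rw [← LinearMap.comp_assoc, hb, ha₀]
  -- Minimality makes `b ∘ₗ a₀` an automorphism over `N`; correcting `b` by its inverse yields a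
  -- retraction `b₀` of `a₀`.
  let u := LinearEquiv.ofBijective _ (hσ.minimal₀ _ hba)
  have hu : ρ ∘ₗ u.symm.toLinearMap = ρ := by
    refine LinearMap.ext fun x => ?_
    conv_rhs => rw [← u.apply_symm_apply x]
    exact (LinearMap.congr_fun hba _).symm
  let b₀ := u.symm.toLinearMap ∘ₗ b
  have hb₀ : ρ ∘ₗ b₀ = π := by rw [← LinearMap.comp_assoc, hu, hb]
  have hba₀ : ∀ x, b₀ (a₀ x) = x := fun x => u.symm_apply_apply x
  have hπθ : π ∘ₗ θ = 0 := hex.linearMap_comp_eq_zero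
  have hρσ : ρ ∘ₗ σ = 0 := hσ.exact.linearMap_comp_eq_zero
  obtain ⟨a₁, ha₁⟩ := Module.projective_lifting_property θ.rangeRestrict
    ((a₀ ∘ₗ σ).codRestrict (LinearMap.range θ) fun x => (hex _).1 <| by
      rw [← LinearMap.comp_apply, ← LinearMap.comp_assoc, ha₀, hρσ, LinearMap.zero_apply])
    θ.surjective_rangeRestrict
  obtain ⟨b₁, hb₁⟩ := Module.projective_lifting_property σ.rangeRestrict
    ((b₀ ∘ₗ θ).codRestrict (LinearMap.range σ) fun x => (hσ.exact _).1 <| by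
      rw [← LinearMap.comp_apply, ← LinearMap.comp_assoc, hb₀, hπθ, LinearMap.zero_apply])
    σ.surjective_rangeRestrict
  replace ha₁ : ∀ x, θ (a₁ x) = a₀ (σ x) :=
    fun x => congrArg Subtype.val (LinearMap.congr_fun ha₁ x)
  replace hb₁ : ∀ x, σ (b₁ x) = b₀ (θ x) :=
    fun x => congrArg Subtype.val (LinearMap.congr_fun hb₁ x)
  have hba₁ : ∀ x, σ (b₁ (a₁ x)) = σ x := fun x => by rw [hb₁, ha₁, hba₀]
  -- In degree one `b₁ ∘ₗ a₁` is only an automorphism, not the identity. Its inverse is harmless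
  -- below because `σ` is unchanged by it.
  let w := LinearEquiv.ofBijective _
    (isRightMinimal_rangeRestrict.1 hσ.minimal₁ (b₁ ∘ₗ a₁) (LinearMap.ext hba₁))
  have hw : ∀ x, b₁ (a₁ (w.symm x)) = x := w.apply_symm_apply
  obtain ⟨g, hg⟩ := hY (h ∘ₗ b₁)
  refine ⟨g ∘ₗ a₀, LinearMap.ext fun x => ?_⟩
  have h1 : σ (w.symm x) = σ x := by rw [← hba₁, hw]
  calc g (a₀ (σ x)) = g (θ (a₁ (w.symm x))) := by rw [ha₁, h1]
    _ = h (b₁ (a₁ (w.symm x))) := LinearMap.congr_fun hg _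
    _ = h x := by rw [hw]

theorem inAdd_self_of_projective [Module.Finite R Q₀] [Module.Projective R Q₀] :
    InAdd R R Q₀ := by
  obtain ⟨n, f, g, -, -, h⟩ := Module.Finite.exists_comp_eq_id_of_projective R Q₀
  refine ⟨Fin n, inferInstance, fun i => LinearMap.proj i ∘ₗ g,
    fun i => f ∘ₗ LinearMap.single R (fun _ => R) i, fun x => ?_⟩
  simp only [LinearMap.comp_apply, ← map_sum]
  refine (congrArg f ?_).trans (LinearMap.congr_fun h x)
  exact Finset.univ_sum_single (g x)

/-- If each map `P₁ → N` extends along `σ : P₁ → P₀`, then there are no nonzero maps from `N` to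
the translate `D Coker Hom(σ, R)`. -/
theorem hom_translate_eq_zero {k J : Type v} [CommRing k] [AddCommGroup J] [Module k J]
    [Algebra k R] [Module.Finite R P₁] [Module.Projective R P₁] [Module.Finite R P₀]
    [Module.Projective R P₀] {σ : P₁ →ₗ[R] P₀}
    (hσ : ∀ h : P₁ →ₗ[R] N, ∃ g : P₀ →ₗ[R] N, g ∘ₗ σ = h)
    (h : N →ₗ[R] Translate k J R R σ) : h = 0 := by
  -- With `T` the transpose, `Hom(N, D T)` is `Hom_k(T ⊗ N, J)`, and `T ⊗ N` is the cokernel of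
  -- `Hom(σ, N)`, which is zero by `hσ`. Dual bases of `P₁` and `P₀` make this explicit, with `β n
  -- (q f)` as the value on `f ⊗ n`.
  obtain ⟨ι, _, a, b, hab⟩ := inAdd_self_of_projective (R := R) (Q₀ := P₁)
  obtain ⟨κ, _, c, d, hcd⟩ := inAdd_self_of_projective (R := R) (Q₀ := P₀)
  let T := Transpose R R σ
  let q : (P₁ →ₗ[R] R) →ₗ[Rᵐᵒᵖ] T := Submodule.mkQ _
  let β : N →+ (T →ₗ[k] J) :=
    { toFun := fun n => h n, map_zero' := map_zero h, map_add' := map_add h }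
  have hβ_smul (r : R) (n f) : β (r • n) (q f) = β n (q (MulOpposite.op r • f)) :=
    LinearMap.congr_fun (show (show T →ₗ[k] J from h (r • n)) = _ from map_smul h r n) (q f)
  have hβ_σ (n) (g : P₀ →ₗ[R] R) : β n (q (g ∘ₗ σ)) = 0 := by
    have : q (g ∘ₗ σ) = 0 := (Submodule.Quotient.mk_eq_zero _).2 ⟨g, rfl⟩
    rw [this, map_zero]
  have hb (i : ι) (r : R) : b i r = r • b i 1 := by rw [← map_smul, smul_eq_mul, mul_one]
  have hd (i : κ) (r : R) : d i r = r • d i 1 := by rw [← map_smul, smul_eq_mul, mul_one]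
  have hexp (f : P₁ →ₗ[R] R) : f = ∑ i, MulOpposite.op (f (b i 1)) • a i := by
    refine LinearMap.ext fun p => ?_
    conv_lhs => rw [← hab p]
    simp [LinearMap.sum_apply, hb _ (a _ p)]
  have key (n : N) (f : P₁ →ₗ[R] R) : β n (q f) = 0 := by
    obtain ⟨g, hg⟩ := hσ (f.smulRight n)
    have hg' (p : P₁) : f p • n = ∑ j, c j (σ p) • g (d j 1) := by
      have := LinearMap.congr_fun hg p
      simp only [LinearMap.comp_apply, LinearMap.smulRight_apply] at this
      rw [← this, ← hcd (σ p), map_sum]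
      simp only [hcd]
      exact Finset.sum_congr rfl fun j _ => by rw [hd, map_smul]
    rw [hexp f, map_sum, map_sum]
    simp only [← hβ_smul, hg', map_sum, LinearMap.sum_apply]
    rw [Finset.sum_comm]
    refine Finset.sum_eq_zero fun j _ => ?_
    simp only [hβ_smul]
    -- For fixed `j` the sum over `i` reassembles `c j ∘ₗ σ`, which is zero in the transpose.
    rw [← map_sum, ← map_sum, ← hβ_σ (g (d j 1)) (c j)]
    exact congrArg (fun f => β _ (q f)) (hexp (c j ∘ₗ σ)).symm
  refine LinearMap.ext fun n => ?_
  change β n = 0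
  refine LinearMap.ext fun t => ?_
  obtain ⟨f, rfl⟩ := Submodule.mkQ_surjective _ t
  exact key n f

end MinimalPresentation

end GorensteinSilting

namespace GorensteinSilting

theorem sum_linearMap_comp {R X Y Z ι : Type*} [Ring R] [AddCommGroup X] [Module R X]
    [AddCommGroup Y] [Module R Y] [AddCommGroup Z] [Module R Z] (g : X →ₗ[R] Y) (s : Finset ι)
    (f : ι → Y →ₗ[R] Z) : (∑ i ∈ s, f i) ∘ₗ g = ∑ i ∈ s, f i ∘ₗ g :=
  LinearMap.ext fun x => by simp [LinearMap.sum_apply]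

/-! ### The functor `Hom_A(E, -)` on `add E` -/

section HomFunctor

variable (A : Type u) [Ring A] (E : Type u) [AddCommGroup E] [Module A E]

/-- `Hom_A(E, Y)` as a left module over `End_A(E)ᵒᵖ`. -/
abbrev EHom (Y : Type u) [AddCommGroup Y] [Module A Y] : Type u :=
  LeftHom A (CMAuslander A E) E Y

variable {A} {G Y Z N : Type u} [AddCommGroup Y] [Module A Y] [AddCommGroup Z] [Module A Z]
  [AddCommGroup G] [Module A G]

/-- The map `Hom_A(E, f)` of `End_A(E)ᵒᵖ`-modules. -/
def EHom.map (f : Y →ₗ[A] Z) : EHom A E Y →ₗ[CMAuslander A E] EHom A E Z where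
  toFun h := f ∘ₗ (show E →ₗ[A] Y from h)
  map_add' _ _ := LinearMap.comp_add _ _ _
  map_smul' _ _ := rfl

variable {E}

/-- A linear map out of `Hom_A(E, G)` with `G` in `add E` is determined by finitely many values. -/
theorem EHom.apply_eq_sum [AddCommGroup N] [Module (CMAuslander A E) N] {ι : Type} [Fintype ι]
    {a : ι → G →ₗ[A] E} {b : ι → E →ₗ[A] G} (hab : ∀ x, ∑ i, b i (a i x) = x)
    (φ : EHom A E G →ₗ[CMAuslander A E] N) (h : E →ₗ[A] G) :
    φ h = ∑ i, (show CMAuslander A E from MulOpposite.op (a i ∘ₗ h)) •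
      φ (show EHom A E G from b i) := by
  have : (show EHom A E G from h) = ∑ i, (show CMAuslander A E from MulOpposite.op (a i ∘ₗ h)) •
      (show EHom A E G from b i) := by
    refine LinearMap.ext fun x => (hab (h x)).symm.trans ?_
    exact (LinearMap.sum_apply Finset.univ (fun i => b i ∘ₗ (a i ∘ₗ h)) x).symm
  refine (congrArg φ this).trans ?_
  rw [map_sum]
  exact Finset.sum_congr rfl fun i _ => map_smul _ _ _

theorem EHom.exists_map_eq (hG : InAdd A E G) (φ : EHom A E G →ₗ[CMAuslander A E] EHom A E Y) :
    ∃ f : G →ₗ[A] Y, EHom.map E f = φ := by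
  obtain ⟨ι, _, a, b, hab⟩ := hG
  refine ⟨∑ i, (show E →ₗ[A] Y from φ (b i)) ∘ₗ a i, LinearMap.ext fun h => ?_⟩
  refine Eq.trans ?_ (EHom.apply_eq_sum hab φ h).symm
  exact sum_linearMap_comp (show E →ₗ[A] G from h) _ _

/-- An element `y` is the image of `1` under `A → Y`, and `1` is a sum of elements coming from `E`.
-/
theorem EHom.map_injective (hA : InAdd A E A) {f g : Y →ₗ[A] Z}
    (h : EHom.map E f = EHom.map E g) : f = g := by
  obtain ⟨ι, _, a, b, hab⟩ := hA
  refine LinearMap.ext fun y => ?_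
  have hy : y = ∑ i, LinearMap.toSpanSingleton A Y y (b i (a i 1)) := by
    rw [← map_sum, hab, LinearMap.toSpanSingleton_apply, one_smul]
  rw [hy, map_sum, map_sum]
  refine Finset.sum_congr rfl fun i _ => ?_
  have := LinearMap.congr_fun h (show EHom A E Y from LinearMap.toSpanSingleton A Y y ∘ₗ b i)
  exact LinearMap.congr_fun (show _ ∘ₗ _ = _ ∘ₗ _ from this) (a i 1)

/-- The map of left `End_A(E)ᵒᵖ`-modules `Hom_A(E, G) → End_A(E)ᵒᵖ` given by `f : G → E`. -/
def EHom.toRing (f : G →ₗ[A] E) : EHom A E G →ₗ[CMAuslander A E] CMAuslander A E where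
  toFun h := MulOpposite.op (f ∘ₗ (show E →ₗ[A] G from h))
  map_add' _ _ := congrArg MulOpposite.op (LinearMap.comp_add _ _ _)
  map_smul' _ _ := rfl

theorem EHom.toRing_surjective (hG : InAdd A E G)
    (φ : EHom A E G →ₗ[CMAuslander A E] CMAuslander A E) : ∃ f, EHom.toRing f = φ := by
  obtain ⟨ι, _, a, b, hab⟩ := hG
  refine ⟨∑ i, (MulOpposite.unop (φ (b i)) : Module.End A E) ∘ₗ a i, LinearMap.ext fun h => ?_⟩
  refine Eq.trans ?_ (EHom.apply_eq_sum hab φ h).symm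
  refine (congrArg MulOpposite.op (sum_linearMap_comp (show E →ₗ[A] G from h) _ _)).trans ?_
  exact Finset.op_sum _ _

theorem EHom.finite (hG : InAdd A E G) : Module.Finite (CMAuslander A E) (EHom A E G) := by
  obtain ⟨ι, _, a, b, hab⟩ := hG
  refine Module.Finite.of_surjective
    (Fintype.linearCombination (CMAuslander A E) fun i => (show EHom A E G from b i)) fun h => ?_
  refine ⟨fun i => MulOpposite.op (a i ∘ₗ (show E →ₗ[A] G from h)), ?_⟩
  exact (EHom.apply_eq_sum hab LinearMap.id h).symm

theorem EHom.projective (hG : InAdd A E G) :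
    Module.Projective (CMAuslander A E) (EHom A E G) := by
  obtain ⟨ι, _, a, b, hab⟩ := hG
  refine Module.Projective.of_split (LinearMap.pi fun i => EHom.toRing (a i))
    (Fintype.linearCombination (CMAuslander A E) fun i => (show EHom A E G from b i))
    (LinearMap.ext fun h => ?_)
  exact (EHom.apply_eq_sum hab LinearMap.id h).symm

end HomFunctor

/-! ### Transfer of presentations and translates to the CM-Auslander algebra -/

section Presentations

variable {A : Type u} [Ring A] {G₁ G₀ M N : Type u} [AddCommGroup G₁] [Module A G₁]
  [AddCommGroup G₀] [Module A G₀] [AddCommGroup M] [Module A M] [AddCommGroup N] [Module A N]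
  {θ : G₁ →ₗ[A] G₀} {π : G₀ →ₗ[A] M}

/-- `G₁ → G₀ → M → 0` is a presentation by modules in `add E` that is exact and stays exact under
`Hom_A(E, -)`. -/
structure IsAddPresentation (E : Type u) [AddCommGroup E] [Module A E] (θ : G₁ →ₗ[A] G₀)
    (π : G₀ →ₗ[A] M) : Prop where
  inAdd₁ : InAdd A E G₁
  inAdd₀ : InAdd A E G₀
  exact : Function.Exact θ π
  surjective : Function.Surjective π
  map_exact : Function.Exact (EHom.map E θ) (EHom.map E π)
  map_surjective : Function.Surjective (EHom.map E π)

theorem IsProperGprojPresentation.isAddPresentation [IsArtinianRing A] {n : ℕ} {E : Fin n → Type u}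
    [∀ i, AddCommGroup (E i)] [∀ i, Module A (E i)] (hE : IsCompleteGprojList A E)
    (h : IsProperGprojPresentation θ π) : IsAddPresentation (∀ i, E i) θ π where
  inAdd₁ := hE.inAdd h.gorensteinProjective₁
  inAdd₀ := hE.inAdd h.gorensteinProjective₀
  exact := h.exact
  surjective := h.surjective
  map_exact f := by
    constructor
    · intro hf
      have hf' (x) : π ((show (∀ i, E i) →ₗ[A] G₀ from f) x) = 0 :=
        LinearMap.congr_fun (show π ∘ₗ _ = 0 from hf) x
      choose g hg using fun i => (h.hom_exact (E i) (hE.gorensteinProjective i)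
        ((show (∀ i, E i) →ₗ[A] G₀ from f) ∘ₗ LinearMap.single A E i)).1
          (LinearMap.ext fun x => hf' _)
      -- The lifts on the factors `E i` are assembled to the whole product. `ℕ` serves only as a
      -- ring of scalars commuting with the possibly noncommutative `A`.
      refine ⟨LinearMap.lsum A E ℕ g, LinearMap.pi_ext' fun i => (Eq.trans ?_ (hg i))⟩
      refine LinearMap.ext fun x => congrArg θ ?_
      exact LinearMap.lsum_piSingle _ _ _ _ _ _
    · rintro ⟨g, rfl⟩
      exact LinearMap.ext fun x => (h.exact _).2 ⟨_, rfl⟩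
  map_surjective f := by
    choose g hg using fun i => h.hom_surjective (E i) (hE.gorensteinProjective i)
        ((show (∀ i, E i) →ₗ[A] M from f) ∘ₗ LinearMap.single A E i)
    refine ⟨LinearMap.lsum A E ℕ g, LinearMap.pi_ext' fun i => (Eq.trans ?_ (hg i))⟩
    refine LinearMap.ext fun x => congrArg π ?_
    exact LinearMap.lsum_piSingle _ _ _ _ _ _

variable {E : Type u} [AddCommGroup E] [Module A E]

/-- Fullness on `add E` realises the composite with `G₀ → M`; faithfulness shows that the realising
map kills `θ`, so it descends to `M`. -/
theorem IsAddPresentation.exists_map_eq (h : IsAddPresentation E θ π) (hA : InAdd A E A)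
    (φ : EHom A E M →ₗ[CMAuslander A E] EHom A E N) : ∃ f : M →ₗ[A] N, EHom.map E f = φ := by
  obtain ⟨f, hf⟩ := EHom.exists_map_eq h.inAdd₀ (φ ∘ₗ EHom.map E π)
  have hfθ : f ∘ₗ θ = 0 := by
    refine EHom.map_injective hA (LinearMap.ext fun x => ?_)
    have h1 := LinearMap.congr_fun hf (EHom.map E θ x)
    rw [LinearMap.comp_apply, (h.map_exact _).2 ⟨x, rfl⟩, map_zero] at h1
    exact h1
  have hker : LinearMap.ker π ≤ LinearMap.ker f := by
    intro p hp
    obtain ⟨x, rfl⟩ := (h.exact p).1 hp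
    exact LinearMap.congr_fun hfθ x
  obtain ⟨t, ht⟩ := exists_comp_eq_of_ker_le h.surjective hker
  refine ⟨t, LinearMap.ext fun x => ?_⟩
  obtain ⟨y, rfl⟩ := h.map_surjective x
  refine Eq.trans ?_ (LinearMap.congr_fun hf y)
  exact congrArg (fun f => EHom.map E f y) ht

theorem IsAddPresentation.nonempty_equiv {G₁' G₀' : Type u} [AddCommGroup G₁'] [Module A G₁']
    [AddCommGroup G₀'] [Module A G₀'] {θ' : G₁' →ₗ[A] G₀'} {π' : G₀' →ₗ[A] N}
    (h : IsAddPresentation E θ π) (h' : IsAddPresentation E θ' π') (hA : InAdd A E A)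
    (e : EHom A E M ≃ₗ[CMAuslander A E] EHom A E N) : Nonempty (M ≃ₗ[A] N) := by
  obtain ⟨f, hf⟩ := h.exists_map_eq hA e.toLinearMap
  obtain ⟨g, hg⟩ := h'.exists_map_eq hA e.symm.toLinearMap
  refine ⟨LinearEquiv.ofLinearMap f g (EHom.map_injective hA <| LinearMap.ext fun x => ?_)
    (EHom.map_injective hA <| LinearMap.ext fun x => ?_)⟩
  · change EHom.map E f (EHom.map E g x) = x
    simp [hf, hg]
  · change EHom.map E g (EHom.map E f x) = x
    simp [hf, hg]

/-- A decomposition is an idempotent endomorphism, and by full faithfulness it comes from an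
idempotent of `M`. -/
theorem IsAddPresentation.isIndecomposable (h : IsAddPresentation E θ π) (hA : InAdd A E A)
    (hM : IsIndecomposable A M) : IsIndecomposable (CMAuslander A E) (EHom A E M) := by
  constructor
  · by_contra hn
    rw [not_nontrivial_iff_subsingleton] at hn
    have h0 : (LinearMap.id : M →ₗ[A] M) = 0 :=
      EHom.map_injective hA (LinearMap.ext fun x => Subsingleton.elim _ _)
    obtain ⟨x, y, hxy⟩ := hM.1
    exact hxy ((LinearMap.congr_fun h0 x).trans (LinearMap.congr_fun h0 y).symm)
  · intro p q hpq
    obtain ⟨e, he⟩ := h.exists_map_eq hA (p.projection q hpq)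
    have hidem : IsIdempotentElem e := by
      refine EHom.map_injective hA (LinearMap.ext fun x => ?_)
      change EHom.map E e (EHom.map E e x) = EHom.map E e x
      rw [he]
      exact LinearMap.congr_fun (Submodule.isIdempotentElem_projection hpq) x
    rcases hM.2 _ _ (LinearMap.IsIdempotentElem.isCompl hidem) with h1 | h1
    · left
      rw [LinearMap.range_eq_bot] at h1
      subst h1
      rw [← Submodule.range_projection hpq, LinearMap.range_eq_bot, ← he]
      exact LinearMap.ext fun x => LinearMap.zero_comp (show E →ₗ[A] M from x)
    · right
      have h2 : e = LinearMap.id := by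
        refine LinearMap.ext fun x => LinearMap.ker_eq_bot.1 h1 ?_
        exact LinearMap.congr_fun hidem x
      subst h2
      rw [← Submodule.ker_projection hpq, ← he, LinearMap.ker_eq_bot]
      exact Function.injective_id

theorem IsAddPresentation.finite (h : IsAddPresentation E θ π) :
    Module.Finite (CMAuslander A E) (EHom A E M) :=
  have := EHom.finite h.inAdd₀
  Module.Finite.of_surjective _ h.map_surjective

theorem EHom.isRightMinimal_map (hG : InAdd A E G₁) (hA : InAdd A E A) (hθ : IsRightMinimal θ) :
    IsRightMinimal (EHom.map E θ) := by
  intro φ hφ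
  obtain ⟨f, rfl⟩ := EHom.exists_map_eq hG φ
  have hf : Function.Bijective f := hθ f (EHom.map_injective hA hφ)
  let e := LinearEquiv.ofBijective f hf
  refine Function.bijective_iff_has_inverse.2
    ⟨EHom.map E e.symm.toLinearMap, fun x => ?_, fun x => ?_⟩
  · exact LinearMap.ext fun y => e.symm_apply_apply _
  · exact LinearMap.ext fun y => e.apply_symm_apply _

theorem IsAddPresentation.isMinimalProjectivePresentation (h : IsAddPresentation E θ π)
    (hA : InAdd A E A) (h₀ : IsRightMinimal π) (h₁ : IsRightMinimal θ) :
    IsMinimalProjectivePresentation (EHom.map E θ) (EHom.map E π) where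
  finite₁ := EHom.finite h.inAdd₁
  finite₀ := EHom.finite h.inAdd₀
  projective₁ := EHom.projective h.inAdd₁
  projective₀ := EHom.projective h.inAdd₀
  exact := h.map_exact
  surjective := h.map_surjective
  minimal₀ := EHom.isRightMinimal_map h.inAdd₀ hA h₀
  minimal₁ := isRightMinimal_rangeRestrict.2 (EHom.isRightMinimal_map h.inAdd₁ hA h₁)

variable {k J : Type v} [CommRing k] [AddCommGroup J] [Module k J] [Algebra k A] [Module k E]
  [IsScalarTower k A E]

/-- The comparison map from the translate of `Hom_A(E, θ)` to the relative translate of `θ`. -/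
theorem EHom.exists_translate_injective (hG : InAdd A E G₁) :
    ∃ t : Translate k J (CMAuslander A E) (CMAuslander A E) (EHom.map E θ)
      →ₗ[CMAuslander A E] Translate k J (CMAuslander A E) E θ, Function.Injective t := by
  let c : (G₁ →ₗ[A] E) →ₗ[(CMAuslander A E)ᵐᵒᵖ]
      (EHom A E G₁ →ₗ[CMAuslander A E] CMAuslander A E) :=
    { toFun := EHom.toRing
      map_add' := fun f g => LinearMap.ext fun h =>
        congrArg MulOpposite.op (LinearMap.add_comp (show E →ₗ[A] G₁ from h) g f)
      map_smul' := fun _ _ => rfl }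
  -- Surjectivity of `c` passes to the cokernels, and `Hom_k(-, J)` turns it into injectivity.
  have hc : Function.Surjective c := EHom.toRing_surjective hG
  let T := Transpose (CMAuslander A E) E θ
  let T' := Transpose (CMAuslander A E) (CMAuslander A E) (EHom.map E θ)
  let w : T →ₗ[(CMAuslander A E)ᵐᵒᵖ] T' := Submodule.mapQ _ _ c (by
    rintro _ ⟨f, rfl⟩
    exact ⟨EHom.toRing f, rfl⟩)
  have hw : Function.Surjective w := by
    intro y
    obtain ⟨φ, rfl⟩ := Submodule.mkQ_surjective _ y
    obtain ⟨f, rfl⟩ := hc φ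
    exact ⟨Submodule.mkQ _ f, rfl⟩
  let w' : T →ₗ[k] T' := w.restrictScalars k
  refine ⟨{ toFun := fun y => (show T' →ₗ[k] J from y) ∘ₗ w'
            map_add' := fun _ _ => LinearMap.add_comp _ _ _
            map_smul' := fun l y => LinearMap.ext fun x =>
              congrArg (show T' →ₗ[k] J from y) (map_smul w (MulOpposite.op l) x).symm }, ?_⟩
  intro y z hyz
  exact (LinearMap.cancel_right (f := (show T' →ₗ[k] J from y)) (f' := (show T' →ₗ[k] J from z))
    (g := w') hw).1 hyz

end Presentations

end GorensteinSilting

/-! ### τ-rigidity of the images and pulling back finiteness -/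

namespace GorensteinSilting

theorem FinitelyManyIsoClasses.mono {R : Type u} [Ring R] {P Q : ModuleCat.{u} R → Prop}
    (h : FinitelyManyIsoClasses R Q) (hPQ : ∀ M, P M → Q M) : FinitelyManyIsoClasses R P := by
  obtain ⟨n, X, hX⟩ := h
  exact ⟨n, X, fun M hM => hX M (hPQ M hM)⟩

theorem FinitelyManyIsoClasses.of_reflect {R S : Type u} [Ring R] [Ring S]
    {P : ModuleCat.{u} R → Prop} {Q : ModuleCat.{u} S → Prop} (h : FinitelyManyIsoClasses S Q)
    (F : ModuleCat.{u} R → ModuleCat.{u} S) (hPQ : ∀ M, P M → Q (F M))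
    (hF : ∀ M N, P M → P N → Nonempty (F M ≃ₗ[S] F N) → Nonempty (M ≃ₗ[R] N)) :
    FinitelyManyIsoClasses R P := by
  obtain ⟨n, X, hX⟩ := h
  -- Each class that is hit gets one preimage, chosen independently of `M`; `PUnit` fills the
  -- classes that are not hit.
  have hY (i) : ∃ Y, ∀ M, P M → Nonempty (F M ≃ₗ[S] X i) → P Y ∧ Nonempty (F Y ≃ₗ[S] X i) := by
    by_cases hi : ∃ M, P M ∧ Nonempty (F M ≃ₗ[S] X i)
    · exact hi.imp fun M hM _ _ _ => hM
    · exact ⟨ModuleCat.of R PUnit, fun M hM h => absurd ⟨M, hM, h⟩ hi⟩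
  choose Y hY using hY
  refine ⟨n, Y, fun M hM => ?_⟩
  obtain ⟨i, ⟨e⟩⟩ := hX (F M) (hPQ M hM)
  obtain ⟨h1, ⟨e'⟩⟩ := hY i M hM ⟨e⟩
  exact ⟨i, hF _ _ hM h1 ⟨e.trans e'.symm⟩⟩

section

variable {k : Type v} [CommRing k] {J : Type v} [AddCommGroup J] [Module k J]
  {A : Type u} [Ring A] [Algebra k A] {E : Type u} [AddCommGroup E] [Module A E] [Module k E]
  [IsScalarTower k A E] {M G₁ G₀ : Type u} [AddCommGroup G₁] [Module A G₁]
  [AddCommGroup G₀] [Module A G₀] [AddCommGroup M] [Module A M] {θ : G₁ →ₗ[A] G₀}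
  {π : G₀ →ₗ[A] M}

/-- An endomorphism is determined by its values on finitely many `k`-generators of `E`, so the
algebra embeds `k`-linearly in a finite power of `E`. -/
theorem isArtinianRing_cmAuslander [IsArtinianRing k] [Module.Finite k E] :
    IsArtinianRing (CMAuslander A E) := by
  obtain ⟨n, p, hp⟩ := Module.Finite.exists_fin' k E
  let r : CMAuslander A E →ₗ[k] Fin n → E :=
    { toFun := fun b i => (show Module.End A E from MulOpposite.unop b) (p (Pi.single i 1))
      map_add' := fun _ _ => rfl
      map_smul' := fun _ _ => rfl }
  have hr : Function.Injective r := by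
    intro b c hbc
    refine MulOpposite.unop_injective (LinearMap.ext fun x => ?_)
    obtain ⟨y, rfl⟩ := hp x
    have : (show Module.End A E from MulOpposite.unop b).restrictScalars k ∘ₗ p =
        (show Module.End A E from MulOpposite.unop c).restrictScalars k ∘ₗ p :=
      (Pi.basisFun k (Fin n)).ext fun i => by
        simp only [LinearMap.comp_apply, Pi.basisFun_apply]
        exact congrFun hbc i
    exact LinearMap.congr_fun this y
  have : IsArtinian k (CMAuslander A E) := isArtinian_of_injective r hr
  exact isArtinian_of_tower k this

theorem IsAddPresentation.isTauRigid_of_forall_eq_zero (h : IsAddPresentation E θ π)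
    (hA : InAdd A E A) (h₀ : IsRightMinimal π) (h₁ : IsRightMinimal θ)
    (hM : ∀ h : EHom A E M →ₗ[CMAuslander A E] Translate k J (CMAuslander A E) E θ, h = 0) :
    IsTauRigid k J (CMAuslander A E) (EHom A E M) := by
  obtain ⟨t, ht⟩ := EHom.exists_translate_injective (k := k) (J := J) (θ := θ) h.inAdd₁
  refine ⟨ModuleCat.of _ (EHom A E G₁), ModuleCat.of _ (EHom A E G₀), EHom.map E θ, EHom.map E π,
    h.isMinimalProjectivePresentation hA h₀ h₁, fun f => LinearMap.ext fun x => ht ?_⟩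
  exact (LinearMap.congr_fun (hM (t ∘ₗ f)) x).trans (map_zero t).symm

/-- The image of `θ` is a projective presentation that need not be minimal, so the extension
property is first carried over to a minimal one. -/
theorem IsAddPresentation.isTauRigid_of_mem_classD [IsArtinianRing (CMAuslander A E)]
    (h : IsAddPresentation E θ π) (hM : ModuleCat.of A M ∈ classD θ) :
    IsTauRigid k J (CMAuslander A E) (EHom A E M) := by
  have := h.finite
  have := EHom.projective h.inAdd₁
  have := EHom.projective h.inAdd₀
  obtain ⟨P₁, P₀, σ, ρ, hσ⟩ :=
    exists_isMinimalProjectivePresentation (R := CMAuslander A E) (EHom A E M)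
  have := hσ.finite₁
  have := hσ.finite₀
  have := hσ.projective₁
  have := hσ.projective₀
  refine ⟨P₁, P₀, σ, ρ, hσ, hom_translate_eq_zero
    (hσ.extend h.map_exact h.map_surjective fun φ => ?_)⟩
  obtain ⟨f, rfl⟩ := EHom.exists_map_eq h.inAdd₁ φ
  obtain ⟨g, hg⟩ := hM f
  exact ⟨EHom.map E g, congrArg (EHom.map E) hg⟩

end

end GorensteinSilting

open GorensteinSilting in
/-- `A` is an Artin `k`-algebra of finite CM-type, `J` is the injective envelope of `k / rad k`
(which gives the duality `D = Hom_k(-, J)`), and `∏ i, E i`, a finite product and hence the direct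
sum of the `E i`, is the Gorenstein-projective generator. -/
theorem corollary2p13
    {k : Type v} [CommRing k] [IsArtinianRing k]
    (J : Type v) [AddCommGroup J] [Module k J]
    (hJ : IsInjectiveEnvelope k (k ⧸ Ring.jacobson k) J)
    {A : Type u} [Ring A] [Algebra k A] [Module.Finite k A]
    (hA : IsFiniteCMType A)
    {n : ℕ} (E : Fin n → Type u) [∀ i, AddCommGroup (E i)] [∀ i, Module A (E i)]
    [∀ i, Module k (E i)] [∀ i, IsScalarTower k A (E i)]
    (hE : IsCompleteGprojList A E)
    (hfin : IsTauTiltingFinite k J (CMAuslander A (∀ i, E i))) :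
    IsTauGTiltingFinite k J A (∀ i, E i) ∧
      FinitelyManyIsoClasses A fun T =>
        IsIndecomposable A T ∧ IsPartialGorensteinSilting A T := by
  have hart : IsArtinianRing A := IsArtinianRing.of_finite k A
  have hEk : ∀ i, Module.Finite k (E i) := fun i =>
    have := (hE.gorensteinProjective i).finite
    Module.Finite.trans A (E i)
  have hΛ : IsArtinianRing (CMAuslander A (∀ i, E i)) := isArtinianRing_cmAuslander (k := k)
  have hgen : InAdd A (∀ i, E i) A := hE.inAdd isGorensteinProjective_of_projective
  -- This class contains both kinds of modules; the presentation is kept because preserving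
  -- indecomposability and reflecting isomorphism rest on it.
  suffices H : FinitelyManyIsoClasses A fun M => IsIndecomposable A M ∧
      IsTauRigid k J (CMAuslander A (∀ i, E i)) (EHom A (∀ i, E i) M) ∧
      ∃ (G₁ G₀ : ModuleCat.{u} A) (θ : G₁ →ₗ[A] G₀) (π : G₀ →ₗ[A] M),
        IsAddPresentation (∀ i, E i) θ π by
    refine ⟨H.mono ?_, H.mono ?_⟩
    · rintro M ⟨-, hM, G₁, G₀, θ, π, h, hzero⟩
      have h' := h.toIsProperGprojPresentation.isAddPresentation hE
      exact ⟨hM, h'.isTauRigid_of_forall_eq_zero hgen h.minimal₀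
        (isRightMinimal_rangeRestrict.1 h.minimal₁) hzero, G₁, G₀, θ, π, h'⟩
    · rintro M ⟨hM, G₁, G₀, θ, π, h, -, hmem⟩
      have h' := h.isAddPresentation hE
      exact ⟨hM, h'.isTauRigid_of_mem_classD hmem, G₁, G₀, θ, π, h'⟩
  refine FinitelyManyIsoClasses.of_reflect hfin
    (fun M => ModuleCat.of _ (EHom A (∀ i, E i) M)) ?_ ?_
  · rintro M ⟨hM, hτ, G₁, G₀, θ, π, h⟩
    exact ⟨h.finite, h.isIndecomposable hgen hM, hτ⟩
  · rintro M N ⟨-, -, G₁, G₀, θ, π, h⟩ ⟨-, -, G₁', G₀', θ', π', h'⟩ ⟨e⟩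
    exact h.nonempty_equiv h' hgen e
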